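/- Let $V\in C^2(\mathbb{R}^n)$ be such that $\mu(\mathrm{d}x)=e^{-V(x)}\,\mathrm{d}x$ is a probability measure on $\mathbb{R}^n$, and suppose that $\mathrm{Hess}(V)\geqslant c\,\mathrm{Id}$ on $\mathbb{R}^n$ for some constant $c>0$. Let $\mathcal{E}(f,g)=\int \nabla f\cdot\nabla g\,\mathrm{d}\mu$ be the associated Dirichlet form, whose domain $\mathcal{D}(\mathcal{E})\subset L^2(\mu)$ is the closure of $C_c^\infty(\mathbb{R}^n)$ with respect to the norm $\left(\int f^2\,\mathrm{d}\mu+\mathcal{E}(f,f)\right)^{1/2}$. Then $\mu$ satisfies the log-Sobolev inequality with constant $2/c$: for every $f\in\mathcal{D}(\mathcal{E})$, the function $f^2\log f^2$ is $\mu$-integrable and \[ \mathrm{Ent}(f^2):=\int f^2\log f^2\,\mathrm{d}\mu-\left(\int f^2\,\mathrm{d}\mu\right)\log\left(\int f^2\,\mathrm{d}\mu\right)\leqslant \frac{2}{c}\,\mathcal{E}(f,f), \] with the convention $0\log 0=0$. -/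

import Mathlib

open MeasureTheory Filter Topology
open scoped ContDiff

noncomputable section

/-- The measure `e^{-V} dx` on `ℝⁿ`. -/
def gibbsMeasure {n : ℕ} (V : EuclideanSpace ℝ (Fin n) → ℝ) :
    Measure (EuclideanSpace ℝ (Fin n)) :=
  (volume : Measure (EuclideanSpace ℝ (Fin n))).withDensity
    fun x => ENNReal.ofReal (Real.exp (-V x))

/-- `f ∈ L²(μ)` and `G ∈ L²(μ; ℝⁿ)` are the limits in `L²(μ)` of `φ k` and `∇ (φ k)` for some
sequence of smooth compactly supported functions `φ k`. In other words, `(f, G)` lies in the closure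
of the graph of the gradient on `C_c^∞(ℝⁿ)`, i.e. `f` lies in the closure of `C_c^∞(ℝⁿ)` for the
norm `(‖f‖² + 𝓔(f, f))^{1/2}`. -/
def IsDirichletGradient {n : ℕ} (μ : Measure (EuclideanSpace ℝ (Fin n)))
    (f : EuclideanSpace ℝ (Fin n) → ℝ)
    (G : EuclideanSpace ℝ (Fin n) → EuclideanSpace ℝ (Fin n)) : Prop :=
  MemLp f 2 μ ∧ MemLp G 2 μ ∧
    ∃ φ : ℕ → EuclideanSpace ℝ (Fin n) → ℝ,
      (∀ k, ContDiff ℝ ∞ (φ k)) ∧ (∀ k, HasCompactSupport (φ k)) ∧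
      Tendsto (fun k => eLpNorm (fun x => φ k x - f x) 2 μ) atTop (𝓝 0) ∧
      Tendsto (fun k => eLpNorm (fun x => gradient (φ k) x - G x) 2 μ) atTop (𝓝 0)

/-- The domain `𝓓(𝓔)` in `L²(μ)` of the Dirichlet form. -/
def dirichletDomain {n : ℕ} (μ : Measure (EuclideanSpace ℝ (Fin n))) :
    Set (EuclideanSpace ℝ (Fin n) → ℝ) :=
  {f | ∃ G, IsDirichletGradient μ f G}

open Classical in
/-- The gradient of `f ∈ 𝓓(𝓔)`, which is `μ`-a.e. unique for `μ = e^{-V} dx`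
(see `IsDirichletGradient.ae_unique`). -/
def dirichletGradient {n : ℕ} (μ : Measure (EuclideanSpace ℝ (Fin n)))
    (f : EuclideanSpace ℝ (Fin n) → ℝ) : EuclideanSpace ℝ (Fin n) → EuclideanSpace ℝ (Fin n) :=
  if h : ∃ G, IsDirichletGradient μ f G then h.choose else 0

/-- The Dirichlet form `𝓔(f, g) = ∫ Γ(f, g) dμ` with `Γ(f, g) = ∇f · ∇g`, for `f, g ∈ 𝓓(𝓔)`. -/
def dirichletForm {n : ℕ} (μ : Measure (EuclideanSpace ℝ (Fin n)))
    (f g : EuclideanSpace ℝ (Fin n) → ℝ) : ℝ :=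
  ∫ x, inner ℝ (dirichletGradient μ f x) (dirichletGradient μ g x) ∂μ

/-- The entropy `Ent(h) = μ(h log h) - μ(h) log μ(h)` of a nonnegative function. -/
def entropy {n : ℕ} (μ : Measure (EuclideanSpace ℝ (Fin n)))
    (h : EuclideanSpace ℝ (Fin n) → ℝ) : ℝ :=
  ∫ x, h x * Real.log (h x) ∂μ - (∫ x, h x ∂μ) * Real.log (∫ x, h x ∂μ)

/-- The log-Sobolev inequality with constant `C`; it includes that `Ent(f²)` is finite. -/
def LogSobolev {n : ℕ} (μ : Measure (EuclideanSpace ℝ (Fin n))) (C : ℝ) : Prop :=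
  ∀ f ∈ dirichletDomain μ,
    Integrable (fun x => f x ^ 2 * Real.log (f x ^ 2)) μ ∧
      entropy μ (fun x => f x ^ 2) ≤ C * dirichletForm μ f f

/-- Pairing with a fixed element of `L²` is continuous. -/
theorem tendsto_integral_mul_of_eLpNorm {α : Type*} [MeasurableSpace α] {μ : Measure α}
    {u : ℕ → α → ℝ} {w : α → ℝ} (hu : ∀ k, MemLp (u k) 2 μ) (hw : MemLp w 2 μ)
    (h : Tendsto (fun k => eLpNorm (u k) 2 μ) atTop (𝓝 0)) :
    Tendsto (fun k => ∫ x, w x * u k x ∂μ) atTop (𝓝 0) := by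
  have hb : ∀ k, eLpNorm (fun x => w x * u k x) 1 μ ≤ eLpNorm w 2 μ * eLpNorm (u k) 2 μ := by
    intro k
    have := eLpNorm_smul_le_mul_eLpNorm (p := 2) (q := 2) (r := 1) (hu k).1 hw.1
    exact this
  have h0 : Tendsto (fun k => eLpNorm w 2 μ * eLpNorm (u k) 2 μ) atTop (𝓝 0) := by
    have := ENNReal.Tendsto.const_mul (a := eLpNorm w 2 μ) h (Or.inr hw.2.ne)
    simpa using this
  have h1 : Tendsto (fun k => eLpNorm (fun x => w x * u k x) 1 μ) atTop (𝓝 0) :=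
    tendsto_of_tendsto_of_tendsto_of_le_of_le tendsto_const_nhds h0 (fun _ => zero_le) hb
  have h2 := tendsto_integral_of_L1' (μ := μ) (fun _ => (0 : ℝ)) aestronglyMeasurable_const
    (F := fun k x => w x * u k x) (l := atTop)
    (Eventually.of_forall fun k => hw.integrable_mul (hu k)) (by
      refine h1.congr fun k => ?_
      congr 1
      ext x
      simp)
  simpa using h2

/-- Convergence in `L²` passes to differences. -/
theorem tendsto_eLpNorm_sub_sub {α F : Type*} [MeasurableSpace α] [NormedAddCommGroup F]
    {μ : Measure α} {u u' : ℕ → α → F} {w w' : α → F}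
    (hu : ∀ k, MemLp (u k) 2 μ) (hu' : ∀ k, MemLp (u' k) 2 μ) (hw : MemLp w 2 μ)
    (hw' : MemLp w' 2 μ)
    (h : Tendsto (fun k => eLpNorm (fun x => u k x - w x) 2 μ) atTop (𝓝 0))
    (h' : Tendsto (fun k => eLpNorm (fun x => u' k x - w' x) 2 μ) atTop (𝓝 0)) :
    Tendsto (fun k => eLpNorm (fun x => (u k x - u' k x) - (w x - w' x)) 2 μ) atTop (𝓝 0) := by
  have h0 : Tendsto (fun k => eLpNorm (fun x => u k x - w x) 2 μ +
      eLpNorm (fun x => u' k x - w' x) 2 μ) atTop (𝓝 0) := by simpa using h.add h'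
  refine tendsto_of_tendsto_of_tendsto_of_le_of_le tendsto_const_nhds h0 (fun _ => zero_le) ?_
  intro k
  have := eLpNorm_sub_le (p := 2) (μ := μ) (f := fun x => u k x - w x)
    (g := fun x => u' k x - w' x) ((hu k).sub hw).1 ((hu' k).sub hw').1 one_le_two
  refine le_trans (le_of_eq (eLpNorm_congr_ae (Eventually.of_forall fun x => ?_))) this
  exact sub_sub_sub_comm _ _ _ _

/-- Integration against `e^{-V} dx` as a weighted Lebesgue integral. -/
theorem integral_gibbsMeasure {n : ℕ} {V : EuclideanSpace ℝ (Fin n) → ℝ} (hV : Continuous V)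
    (u : EuclideanSpace ℝ (Fin n) → ℝ) :
    ∫ x, u x ∂(gibbsMeasure V) = ∫ x, Real.exp (-V x) * u x := by
  rw [gibbsMeasure, integral_withDensity_eq_integral_toReal_smul (by fun_prop) (by simp)]
  simp [ENNReal.toReal_ofReal (Real.exp_pos _).le]

/-- Integration by parts against `e^{-V} dx`. -/
theorem integral_gibbsMeasure_by_parts {n : ℕ} {V : EuclideanSpace ℝ (Fin n) → ℝ}
    (hV : ContDiff ℝ 1 V) {a ψ : EuclideanSpace ℝ (Fin n) → ℝ} (ha : ContDiff ℝ 1 a)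
    (hψ : ContDiff ℝ 1 ψ) (hψc : HasCompactSupport ψ) (v : EuclideanSpace ℝ (Fin n)) :
    ∫ x, ψ x * fderiv ℝ a x v ∂(gibbsMeasure V) =
      - ∫ x, (fderiv ℝ ψ x v - ψ x * fderiv ℝ V x v) * a x ∂(gibbsMeasure V) := by
  rw [integral_gibbsMeasure hV.continuous, integral_gibbsMeasure hV.continuous]
  have hE : ContDiff ℝ 1 (fun x => Real.exp (-V x) * ψ x) := by fun_prop
  have hEc : HasCompactSupport (fun x => Real.exp (-V x) * ψ x) := hψc.mul_left
  have hd : ∀ x, fderiv ℝ (fun x => Real.exp (-V x) * ψ x) x v =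
      Real.exp (-V x) * (fderiv ℝ ψ x v - ψ x * fderiv ℝ V x v) := by
    intro x
    have h1 : HasFDerivAt V (fderiv ℝ V x) x :=
      (hV.differentiable one_ne_zero x).hasFDerivAt
    have h2 : HasFDerivAt ψ (fderiv ℝ ψ x) x :=
      (hψ.differentiable one_ne_zero x).hasFDerivAt
    have h3 : HasFDerivAt (fun x => Real.exp (-V x) * ψ x) _ x := h1.neg.exp.mul h2
    rw [h3.fderiv]
    simp
    ring
  have hda : Continuous fun x => fderiv ℝ a x v :=
    (ha.continuous_fderiv one_ne_zero).clm_apply continuous_const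
  have hdE : Continuous fun x => fderiv ℝ (fun x => Real.exp (-V x) * ψ x) x v :=
    (hE.continuous_fderiv one_ne_zero).clm_apply continuous_const
  have hdEc : HasCompactSupport fun x => fderiv ℝ (fun x => Real.exp (-V x) * ψ x) x v :=
    (hEc.fderiv ℝ).comp_left
      (g := fun L : EuclideanSpace ℝ (Fin n) →L[ℝ] ℝ => L v) (by simp)
  have key := integral_mul_fderiv_eq_neg_fderiv_mul_of_integrable
    (μ := (volume : Measure (EuclideanSpace ℝ (Fin n))))
    (f := fun x => Real.exp (-V x) * ψ x) (g := a) (v := v)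
    ((hdE.mul ha.continuous).integrable_of_hasCompactSupport hdEc.mul_right)
    ((hE.continuous.mul hda).integrable_of_hasCompactSupport hEc.mul_right)
    ((hE.continuous.mul ha.continuous).integrable_of_hasCompactSupport hEc.mul_right)
    (fun x _ => hE.differentiable one_ne_zero x) (fun x _ => ha.differentiable one_ne_zero x)
  simp only [hd] at key
  simpa only [mul_assoc] using key

/-- The gradient on `C_c^∞(ℝⁿ)` is closable in `L²(e^{-V} dx)`, so that gradients are unique. -/
theorem IsDirichletGradient.ae_unique {n : ℕ} {V : EuclideanSpace ℝ (Fin n) → ℝ}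
    (hV : ContDiff ℝ 1 V) [IsFiniteMeasure (gibbsMeasure V)]
    {f : EuclideanSpace ℝ (Fin n) → ℝ}
    {G G' : EuclideanSpace ℝ (Fin n) → EuclideanSpace ℝ (Fin n)}
    (h : IsDirichletGradient (gibbsMeasure V) f G)
    (h' : IsDirichletGradient (gibbsMeasure V) f G') : G =ᵐ[gibbsMeasure V] G' := by
  obtain ⟨hf, hG, φ, hφ, hφc, hφf, hφG⟩ := h
  obtain ⟨-, hG', φ', hφ', hφc', hφf', hφG'⟩ := h'
  have hcont : ∀ {u : EuclideanSpace ℝ (Fin n) → ℝ}, ContDiff ℝ ∞ u → Continuous (gradient u) :=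
    fun hu => (LinearIsometryEquiv.continuous _).comp (hu.continuous_fderiv (by simp))
  have hcs : ∀ {u : EuclideanSpace ℝ (Fin n) → ℝ}, HasCompactSupport u →
      HasCompactSupport (gradient u) :=
    fun hu => (hu.fderiv ℝ).comp_left
      (g := (InnerProductSpace.toDual ℝ (EuclideanSpace ℝ (Fin n))).symm) (by simp)
  have hm : ∀ {u : EuclideanSpace ℝ (Fin n) → ℝ}, ContDiff ℝ ∞ u → HasCompactSupport u →
      MemLp u 2 (gibbsMeasure V) := fun hu hc => hu.continuous.memLp_of_hasCompactSupport hc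
  have hmg : ∀ {u : EuclideanSpace ℝ (Fin n) → ℝ}, ContDiff ℝ ∞ u → HasCompactSupport u →
      MemLp (gradient u) 2 (gibbsMeasure V) :=
    fun hu hc => (hcont hu).memLp_of_hasCompactSupport (hcs hc)
  have ha := tendsto_eLpNorm_sub_sub (fun k => hm (hφ k) (hφc k)) (fun k => hm (hφ' k) (hφc' k))
    hf hf hφf hφf'
  have hg := tendsto_eLpNorm_sub_sub (fun k => hmg (hφ k) (hφc k))
    (fun k => hmg (hφ' k) (hφc' k)) hG hG' hφG hφG'
  simp only [sub_self, sub_zero] at ha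
  have hGi : Integrable (fun x => G x - G' x) (gibbsMeasure V) :=
    (hG.sub hG').integrable one_le_two
  suffices hz : ∀ᵐ x ∂(gibbsMeasure V), G x - G' x = 0 by
    filter_upwards [hz] with x hx using sub_eq_zero.1 hx
  refine ae_eq_zero_of_integral_contDiff_smul_eq_zero hGi.locallyIntegrable ?_
  intro ψ hψ hψc
  have hψ1 : ContDiff ℝ 1 ψ := hψ.of_le (by exact_mod_cast le_top)
  have hψm : MemLp ψ 2 (gibbsMeasure V) := hm hψ hψc
  refine ext_inner_right ℝ fun v => ?_
  have hψG : Integrable (fun x => ψ x • (G x - G' x)) (gibbsMeasure V) :=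
    hGi.locallyIntegrable.integrable_smul_left_of_hasCompactSupport hψ.continuous hψc
  rw [inner_zero_left, real_inner_comm, ← integral_inner hψG]
  have hr : ∀ k, MemLp (fun x => inner ℝ (gradient (φ k) x - gradient (φ' k) x -
      (G x - G' x)) v) 2 (gibbsMeasure V) := fun k =>
    (((hmg (hφ k) (hφc k)).sub (hmg (hφ' k) (hφc' k))).sub (hG.sub hG')).inner_const v
  have hA := tendsto_integral_mul_of_eLpNorm hr hψm (by
    have h0 : Tendsto (fun k => ENNReal.ofReal ‖v‖ * eLpNorm (fun x => gradient (φ k) x -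
        gradient (φ' k) x - (G x - G' x)) 2 (gibbsMeasure V)) atTop (𝓝 0) := by
      simpa using ENNReal.Tendsto.const_mul (a := ENNReal.ofReal ‖v‖) hg (Or.inr ENNReal.ofReal_ne_top)
    refine tendsto_of_tendsto_of_tendsto_of_le_of_le tendsto_const_nhds h0
      (fun _ => zero_le) fun k => ?_
    refine eLpNorm_le_mul_eLpNorm_of_ae_le_mul (Eventually.of_forall fun x => ?_) 2
    rw [mul_comm]
    exact norm_inner_le_norm _ _)
  have hψd : Continuous fun x => fderiv ℝ ψ x v :=
    (hψ1.continuous_fderiv one_ne_zero).clm_apply continuous_const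
  have hVd : Continuous fun x => fderiv ℝ V x v :=
    (hV.continuous_fderiv one_ne_zero).clm_apply continuous_const
  have hwm : MemLp (fun x => fderiv ℝ ψ x v - ψ x * fderiv ℝ V x v) 2 (gibbsMeasure V) := by
    refine MemLp.sub ?_ ?_
    · exact hψd.memLp_of_hasCompactSupport ((hψc.fderiv ℝ).comp_left
        (g := fun L : EuclideanSpace ℝ (Fin n) →L[ℝ] ℝ => L v) (by simp))
    · exact (hψ.continuous.mul hVd).memLp_of_hasCompactSupport hψc.mul_right
  have hB := tendsto_integral_mul_of_eLpNorm
    (fun k => (hm (hφ k) (hφc k)).sub (hm (hφ' k) (hφc' k))) hwm ha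
  have hGv : Integrable (fun x => ψ x * inner ℝ (G x - G' x) v) (gibbsMeasure V) :=
    hψm.integrable_mul ((hG.sub hG').inner_const v)
  have hgk : ∀ k x, inner ℝ (gradient (φ k) x - gradient (φ' k) x) v =
      fderiv ℝ (φ k - φ' k) x v := by
    intro k x
    rw [fderiv_sub ((hφ k).differentiable (by simp) x) ((hφ' k).differentiable (by simp) x),
      inner_sub_left]
    simp [gradient]
  have hC : ∀ k, ∫ x, ψ x * inner ℝ (gradient (φ k) x - gradient (φ' k) x - (G x - G' x)) v
      ∂(gibbsMeasure V) =
      -(∫ x, (fderiv ℝ ψ x v - ψ x * fderiv ℝ V x v) * (φ k - φ' k) x ∂(gibbsMeasure V)) -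
        ∫ x, ψ x * inner ℝ (G x - G' x) v ∂(gibbsMeasure V) := by
    intro k
    have hk1 : ContDiff ℝ 1 (φ k - φ' k) :=
      ((hφ k).sub (hφ' k)).of_le (by exact_mod_cast le_top)
    have hki : Integrable (fun x => ψ x * inner ℝ (gradient (φ k) x - gradient (φ' k) x) v)
        (gibbsMeasure V) :=
      hψm.integrable_mul (((hmg (hφ k) (hφc k)).sub (hmg (hφ' k) (hφc' k))).inner_const v)
    rw [← integral_gibbsMeasure_by_parts hV hk1 hψ1 hψc v]
    simp only [← hgk]
    rw [← integral_sub hki hGv]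
    congr 1
    ext x
    rw [inner_sub_left (gradient (φ k) x - gradient (φ' k) x)]
    ring
  have hD := (hB.neg).sub_const (∫ x, ψ x * inner ℝ (G x - G' x) v ∂(gibbsMeasure V))
  have hE := tendsto_nhds_unique hA (hD.congr fun k => (hC k).symm)
  have hF : ∫ x, inner ℝ v (ψ x • (G x - G' x)) ∂(gibbsMeasure V) =
      ∫ x, ψ x * inner ℝ (G x - G' x) v ∂(gibbsMeasure V) := by
    congr 1
    ext x
    rw [inner_smul_right, real_inner_comm]
  rw [hF]
  linarith

end

/-! This is the Bobkov–Ledoux argument: the log-Sobolev inequality is the first-order term of the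
Prékopa–Leindler inequality along a family that starts at equality. For weights `t + s = 1`,
`prekopa_leindler` is applied to `e^{g/t - V}` and `e^{-V}`. By `add_le_of_le_hessian`, the
convexity of `V` gains `c t s ‖x - y‖² / 2`. This gain absorbs the variation of `g` between `x` and
`z = t x + s y` at the price of `s ‖∇g(z)‖² / (2q)`, where `q → c` as `s → 0`. The result,
`rpow_integral_exp_div_le`, reads `(∫ e^{g/t} dμ)^t ≤ ∫ e^{g + s ‖∇g‖² / (2q)} dμ`. Both sides equal
`∫ e^g dμ` at `s = 0`. Comparing first-order terms gives `Ent(e^g) ≤ (1 / 2c) ∫ ‖∇g‖² e^g dμ`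
(`integral_exp_entropy_le`). With `e^g = φ² + ε` one has `‖∇g‖² e^g ≤ 4 ‖∇φ‖²`, hence the constant
`2 / c`. Letting `ε → 0` settles compactly supported `φ`. Since `y log y` is bounded below, Fatou's
lemma carries both integrability and the inequality to `L²` limits
(`integrable_and_entropy_sq_le_of_tendsto`). -/

open scoped ENNReal Pointwise

/-! ### The Prékopa–Leindler inequality -/

/-- One-dimensional Brunn–Minkowski inequality for compact sets, in weighted form. -/
theorem Real.volume_add_le_of_isCompact {A B C : Set ℝ} (hA : IsCompact A) (hB : IsCompact B)
    (hA0 : A.Nonempty) (hB0 : B.Nonempty) {t s : ℝ} (ht : 0 < t) (hs : 0 < s)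
    (h : ∀ x ∈ A, ∀ y ∈ B, t * x + s * y ∈ C) :
    ENNReal.ofReal t * volume A + ENNReal.ofReal s * volume B ≤ volume C := by
  obtain ⟨a, haA, ha⟩ := hA.exists_isGreatest hA0
  obtain ⟨b, hbB, hb⟩ := hB.exists_isLeast hB0
  have hvol : ∀ (r d : ℝ) (S : Set ℝ), 0 < r →
      volume ((fun x => x + d) '' (r • S)) = ENNReal.ofReal r * volume S := by
    intro r d S hr
    rw [Set.image_add_right, measure_preimage_add_right, Measure.addHaar_smul]
    simp [abs_of_pos hr]
  -- With `a = max A` and `b = min B`, the translates `tA + sb` and `ta + sB` both lie in `C`. The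
  -- first lies to the left of `ta + sb` and the second to its right, so they overlap in at most one
  -- point.
  rw [← hvol t (s * b) A ht, ← hvol s (t * a) B hs]
  have hm : MeasurableSet ((fun x => x + t * a) '' (s • B)) :=
    ((hB.smul s).image (by fun_prop)).measurableSet
  rw [← measure_union₀ hm.nullMeasurableSet]
  · refine measure_mono (Set.union_subset ?_ ?_)
    · rintro _ ⟨_, ⟨x, hx, rfl⟩, rfl⟩
      exact h x hx b hbB
    · rintro _ ⟨_, ⟨y, hy, rfl⟩, rfl⟩
      have := h a haA y hy
      rwa [add_comm] at this
  · refine measure_mono_null (t := {t * a + s * b}) ?_ (by simp)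
    rintro z ⟨⟨_, ⟨x, hx, rfl⟩, h1⟩, ⟨_, ⟨y, hy, rfl⟩, h2⟩⟩
    have h3 := mul_le_mul_of_nonneg_left (ha hx) ht.le
    have h4 := mul_le_mul_of_nonneg_left (hb hy) hs.le
    simp only [smul_eq_mul] at h1 h2
    rw [Set.mem_singleton_iff]
    linarith

/-- One-dimensional Brunn–Minkowski inequality for measurable sets, in weighted form. -/
theorem Real.volume_add_le_of_measurableSet {A B C : Set ℝ} (hA : MeasurableSet A)
    (hB : MeasurableSet B) (hA0 : A.Nonempty) (hB0 : B.Nonempty) {t s : ℝ} (ht : 0 < t)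
    (hs : 0 < s) (h : ∀ x ∈ A, ∀ y ∈ B, t * x + s * y ∈ C) :
    ENNReal.ofReal t * volume A + ENNReal.ofReal s * volume B ≤ volume C := by
  have key : ∀ {S : Set ℝ}, MeasurableSet S → S.Nonempty → volume S ≤
      ⨆ K : {K : Set ℝ // K ⊆ S ∧ IsCompact K ∧ K.Nonempty}, volume (K : Set ℝ) := by
    rintro S hS ⟨a, ha⟩
    refine le_of_forall_lt fun r hr => ?_
    obtain ⟨K, hKS, hK, hrK⟩ := hS.exists_lt_isCompact hr
    -- Adjoining a point of `S` keeps the approximating compact set nonempty, even when `K` is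
    -- empty.
    refine hrK.trans_le ((measure_mono (Set.subset_insert a K)).trans ?_)
    exact le_iSup (fun K : {K : Set ℝ // K ⊆ S ∧ IsCompact K ∧ K.Nonempty} => volume (K : Set ℝ))
      ⟨insert a K, Set.insert_subset ha hKS, hK.insert a, Set.insert_nonempty a K⟩
  have hne : ∀ {S : Set ℝ}, S.Nonempty →
      Nonempty {K : Set ℝ // K ⊆ S ∧ IsCompact K ∧ K.Nonempty} := by
    rintro S ⟨a, ha⟩
    exact ⟨⟨{a}, Set.singleton_subset_iff.2 ha, isCompact_singleton, Set.singleton_nonempty a⟩⟩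
  have := hne hA0
  have := hne hB0
  refine (add_le_add (mul_le_mul_right (key hA hA0) _) (mul_le_mul_right (key hB hB0) _)).trans ?_
  rw [ENNReal.mul_iSup, ENNReal.mul_iSup]
  refine ENNReal.iSup_add_iSup_le fun K L => ?_
  exact Real.volume_add_le_of_isCompact K.2.2.1 L.2.2.1 K.2.2.2 L.2.2.2 ht hs
    fun x hx y hy => h x (K.2.1 hx) y (L.2.1 hy)

/-- If `f` and `g` have the same supremum and `h (t x + s y) ≥ min (f x) (g y)`, then
`∫ h ≥ t ∫ f + s ∫ g`. -/
theorem Real.lintegral_add_le_of_min_le {f g h : ℝ → ℝ} (hf : Measurable f) (hg : Measurable g)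
    (hh : Measurable h) (hf0 : ∀ x, 0 ≤ f x) (hg0 : ∀ x, 0 ≤ g x) (hh0 : ∀ x, 0 ≤ h x)
    (hsup : ∀ l, (∃ x, l < f x) ↔ ∃ y, l < g y) {t s : ℝ} (ht : 0 < t) (hs : 0 < s)
    (H : ∀ x y, min (f x) (g y) ≤ h (t * x + s * y)) :
    ENNReal.ofReal t * (∫⁻ x, ENNReal.ofReal (f x)) +
      ENNReal.ofReal s * (∫⁻ x, ENNReal.ofReal (g x)) ≤
      ∫⁻ x, ENNReal.ofReal (h x) := by
  have hmeas : ∀ u : ℝ → ℝ, Measurable fun l => volume {a : ℝ | l < u a} := fun u =>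
    Antitone.measurable fun l m hlm => measure_mono fun a ha => lt_of_le_of_lt hlm ha
  -- Layer cake: the claim reduces to Brunn–Minkowski for the superlevel sets. Equality of the
  -- suprema makes those of `f` and `g` nonempty at the same levels.
  rw [lintegral_eq_lintegral_meas_lt _ (Eventually.of_forall hf0) hf.aemeasurable,
    lintegral_eq_lintegral_meas_lt _ (Eventually.of_forall hg0) hg.aemeasurable,
    lintegral_eq_lintegral_meas_lt _ (Eventually.of_forall hh0) hh.aemeasurable,
    ← lintegral_const_mul _ (hmeas f), ← lintegral_const_mul _ (hmeas g),
    ← lintegral_add_left ((hmeas f).const_mul _)]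
  refine lintegral_mono fun l => ?_
  by_cases hl : ∃ x, l < f x
  · refine Real.volume_add_le_of_measurableSet (measurableSet_lt measurable_const hf)
      (measurableSet_lt measurable_const hg) hl ((hsup l).1 hl) ht hs fun x hx y hy => ?_
    exact (lt_min hx hy).trans_le (H x y)
  · have h1 : {a | l < f a} = ∅ := Set.eq_empty_of_forall_notMem fun x hx => hl ⟨x, hx⟩
    have h2 : {a | l < g a} = ∅ :=
      Set.eq_empty_of_forall_notMem fun x hx => hl ((hsup l).2 ⟨x, hx⟩)
    simp [h1, h2]

/-- Weighted arithmetic–geometric mean inequality: Young's inequality with exponents `1 / t` and `1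
/ s`. -/
theorem ENNReal.rpow_mul_rpow_le_add {t s : ℝ} (ht : 0 < t) (hs : 0 < s) (hts : t + s = 1)
    (a b : ℝ≥0∞) : a ^ t * b ^ s ≤ ENNReal.ofReal t * a + ENNReal.ofReal s * b := by
  have hpq : (1 / t).HolderConjugate (1 / s) := by
    refine ⟨by simpa using hts, by positivity, by positivity⟩
  have := ENNReal.young_inequality (a ^ t) (b ^ s) hpq
  rw [← ENNReal.rpow_mul, ← ENNReal.rpow_mul, mul_one_div_cancel ht.ne', mul_one_div_cancel hs.ne',
    ENNReal.rpow_one, ENNReal.rpow_one, one_div, one_div, ENNReal.ofReal_inv_of_pos ht,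
    ENNReal.ofReal_inv_of_pos hs, div_eq_mul_inv, div_eq_mul_inv, inv_inv, inv_inv] at this
  rwa [mul_comm _ a, mul_comm _ b]

/-- One-dimensional Prékopa–Leindler inequality for bounded functions. -/
theorem Real.prekopa_leindler_of_bounded {f g h : ℝ → ℝ≥0∞} (hf : Measurable f)
    (hg : Measurable g) (hh : Measurable h) {N : ℝ≥0∞} (hN : N ≠ ⊤) (hfN : ∀ x, f x ≤ N)
    (hgN : ∀ x, g x ≤ N) {t s : ℝ} (ht : 0 < t) (hs : 0 < s) (hts : t + s = 1)
    (H : ∀ x y, f x ^ t * g y ^ s ≤ h (t * x + s * y)) :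
    (∫⁻ x, f x) ^ t * (∫⁻ x, g x) ^ s ≤ ∫⁻ x, h x := by
  set a := ⨆ x, f x with ha
  set b := ⨆ x, g x with hb
  have hfa : ∀ x, f x ≤ a := le_iSup f
  have hgb : ∀ x, g x ≤ b := le_iSup g
  have haN : a ≠ ⊤ := ((iSup_le hfN).trans_lt hN.lt_top).ne
  have hbN : b ≠ ⊤ := ((iSup_le hgN).trans_lt hN.lt_top).ne
  by_cases ha0 : a = 0
  · have : ∀ x, f x = 0 := fun x => le_antisymm ((hfa x).trans ha0.le) zero_le
    simp [this, ENNReal.zero_rpow_of_pos ht]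
  by_cases hb0 : b = 0
  · have : ∀ x, g x = 0 := fun x => le_antisymm ((hgb x).trans hb0.le) zero_le
    simp [this, ENNReal.zero_rpow_of_pos hs]
  have hat0 : a ^ t ≠ 0 := by simp [ENNReal.rpow_eq_zero_iff, ha0, ht.not_gt]
  have hbs0 : b ^ s ≠ 0 := by simp [ENNReal.rpow_eq_zero_iff, hb0, hs.not_gt]
  have hatN : a ^ t ≠ ⊤ := ENNReal.rpow_ne_top_of_nonneg ht.le haN
  have hbsN : b ^ s ≠ ⊤ := ENNReal.rpow_ne_top_of_nonneg hs.le hbN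
  set d := a ^ t * b ^ s with hd
  have hd0 : d ≠ 0 := mul_ne_zero hat0 hbs0
  have hdN : d ≠ ⊤ := ENNReal.mul_ne_top hatN hbsN
  have hf1 : ∀ x, f x / a ≤ 1 := fun x => ENNReal.div_le_of_le_mul (by simpa using hfa x)
  have hg1 : ∀ x, g x / b ≤ 1 := fun x => ENNReal.div_le_of_le_mul (by simpa using hgb x)
  have hfT : ∀ x, f x / a ≠ ⊤ := fun x => ((hf1 x).trans_lt ENNReal.one_lt_top).ne
  have hgT : ∀ x, g x / b ≠ ⊤ := fun x => ((hg1 x).trans_lt ENNReal.one_lt_top).ne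
  have hhT : ∀ x, min (h x / d) 1 ≠ ⊤ := fun x =>
    ((min_le_right _ _).trans_lt ENNReal.one_lt_top).ne
  have hlt : ∀ {u : ℝ → ℝ≥0∞}, (⨆ x, u x) ≠ 0 → (⨆ x, u x) ≠ ⊤ → ∀ l : ℝ,
      (∃ x, l < (u x / ⨆ x, u x).toReal) ↔ l < 1 := by
    intro u hu0 huT l
    have hu1 : ∀ x, (u x / ⨆ x, u x) ≤ 1 := fun x =>
      ENNReal.div_le_of_le_mul (by simpa using le_iSup u x)
    constructor
    · rintro ⟨x, hx⟩
      exact hx.trans_le (ENNReal.toReal_mono ENNReal.one_ne_top (hu1 x))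
    · intro hl
      have h1 : ENNReal.ofReal l * (⨆ x, u x) < ⨆ x, u x := by
        have : ENNReal.ofReal l < 1 := by simpa using hl
        simpa using ENNReal.mul_lt_mul_left hu0 huT this
      obtain ⟨x, hx⟩ := lt_iSup_iff.1 h1
      refine ⟨x, ?_⟩
      have h2 : ENNReal.ofReal l < u x / ⨆ x, u x :=
        (ENNReal.lt_div_iff_mul_lt (Or.inl hu0) (Or.inl huT)).2 hx
      refine lt_of_le_of_lt (le_max_left l 0) ?_
      rw [← ENNReal.toReal_ofReal']
      exact (ENNReal.toReal_lt_toReal ENNReal.ofReal_ne_top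
        ((hu1 x).trans_lt ENNReal.one_lt_top).ne).2 h2
  -- Dividing by the suprema makes both equal to `1`. Capping `h / d` at `1` keeps it finite and
  -- costs nothing, since the minimum it must dominate is at most `1`.
  have key := Real.lintegral_add_le_of_min_le (f := fun x => (f x / a).toReal)
    (g := fun x => (g x / b).toReal) (h := fun x => (min (h x / d) 1).toReal)
    (by fun_prop) (by fun_prop) (by fun_prop) (fun _ => ENNReal.toReal_nonneg)
    (fun _ => ENNReal.toReal_nonneg) (fun _ => ENNReal.toReal_nonneg)
    (fun l => (hlt ha0 haN l).trans (hlt hb0 hbN l).symm) ht hs (by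
      intro x y
      rw [← ENNReal.toReal_min (hfT x) (hgT y)]
      refine ENNReal.toReal_mono (hhT _) (le_min ?_ ((min_le_left _ _).trans (hf1 x)))
      calc min (f x / a) (g y / b)
          = min (f x / a) (g y / b) ^ t * min (f x / a) (g y / b) ^ s := by
            rw [← ENNReal.rpow_add_of_nonneg _ _ ht.le hs.le, hts, ENNReal.rpow_one]
        _ ≤ (f x / a) ^ t * (g y / b) ^ s :=
            mul_le_mul' (ENNReal.rpow_le_rpow (min_le_left _ _) ht.le)
              (ENNReal.rpow_le_rpow (min_le_right _ _) hs.le)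
        _ = (f x ^ t * g y ^ s) / d := by
            rw [ENNReal.div_rpow_of_nonneg _ _ ht.le, ENNReal.div_rpow_of_nonneg _ _ hs.le, hd,
              div_eq_mul_inv, div_eq_mul_inv, div_eq_mul_inv,
              ENNReal.mul_inv (Or.inl hat0) (Or.inl hatN)]
            ring
        _ ≤ h (t * x + s * y) / d := ENNReal.div_le_div_right (H x y) d)
  simp only [ENNReal.ofReal_toReal (hfT _), ENNReal.ofReal_toReal (hgT _),
    ENNReal.ofReal_toReal (hhT _)] at key
  have h1 : ∫⁻ x, min (h x / d) 1 ≤ (∫⁻ x, h x) / d := by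
    rw [div_eq_mul_inv, ← lintegral_mul_const _ hh]
    exact lintegral_mono fun x => min_le_left _ _
  have h2 := (ENNReal.rpow_mul_rpow_le_add ht hs hts _ _).trans (key.trans h1)
  simp only [div_eq_mul_inv] at h2
  rw [lintegral_mul_const _ hf, lintegral_mul_const _ hg, ENNReal.mul_rpow_of_nonneg _ _ ht.le,
    ENNReal.mul_rpow_of_nonneg _ _ hs.le, ENNReal.inv_rpow, ENNReal.inv_rpow] at h2
  have h3 : (∫⁻ x, f x) ^ t * (∫⁻ x, g x) ^ s * d⁻¹ ≤ (∫⁻ x, h x) * d⁻¹ := by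
    refine le_trans (le_of_eq ?_) h2
    rw [hd, ENNReal.mul_inv (Or.inl hat0) (Or.inl hatN)]
    ring
  exact (ENNReal.mul_le_mul_iff_left (ENNReal.inv_ne_zero.2 hdN) (ENNReal.inv_ne_top.2 hd0)).1 h3

/-- One-dimensional Prékopa–Leindler inequality. -/
theorem Real.prekopa_leindler {f g h : ℝ → ℝ≥0∞} (hf : Measurable f)
    (hg : Measurable g) (hh : Measurable h) {t s : ℝ} (ht : 0 < t) (hs : 0 < s) (hts : t + s = 1)
    (H : ∀ x y, f x ^ t * g y ^ s ≤ h (t * x + s * y)) :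
    (∫⁻ x, f x) ^ t * (∫⁻ x, g x) ^ s ≤ ∫⁻ x, h x := by
  by_cases hf0 : ∫⁻ x, f x = 0
  · simp [hf0, ENNReal.zero_rpow_of_pos ht]
  by_cases hg0 : ∫⁻ x, g x = 0
  · simp [hg0, ENNReal.zero_rpow_of_pos hs]
  have hlim : ∀ {u : ℝ → ℝ≥0∞}, Measurable u →
      Tendsto (fun N : ℕ => ∫⁻ x, min (u x) N) atTop (𝓝 (∫⁻ x, u x)) := by
    intro u hu
    refine lintegral_tendsto_of_tendsto_of_monotone (fun N => (by fun_prop)) ?_ ?_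
    · exact Eventually.of_forall fun x N M hNM => min_le_min_left _ (by exact_mod_cast hNM)
    · refine Eventually.of_forall fun x => ?_
      have := (tendsto_const_nhds (x := u x) (f := atTop)).min ENNReal.tendsto_nat_nhds_top
      simpa using this
  -- Truncate at height `N` and let `N → ∞`. The product of the limits is safe from `0 * ∞` because
  -- both integrals are nonzero.
  have h1 := ENNReal.Tendsto.mul
    ((ENNReal.continuous_rpow_const (y := t)).continuousAt.tendsto.comp (hlim hf))
    (Or.inl (by simp [ENNReal.rpow_eq_zero_iff, hf0, ht.not_gt]))
    ((ENNReal.continuous_rpow_const (y := s)).continuousAt.tendsto.comp (hlim hg))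
    (Or.inl (by simp [ENNReal.rpow_eq_zero_iff, hg0, hs.not_gt]))
  refine le_of_tendsto' h1 fun N => ?_
  refine Real.prekopa_leindler_of_bounded (N := N) (by fun_prop) (by fun_prop) hh (by simp)
    (fun _ => min_le_right _ _) (fun _ => min_le_right _ _) ht hs hts fun x y => ?_
  exact (mul_le_mul' (ENNReal.rpow_le_rpow (min_le_left _ _) ht.le)
    (ENNReal.rpow_le_rpow (min_le_left _ _) hs.le)).trans (H x y)

/-- Prékopa–Leindler inequality on `ℝⁿ`. -/
theorem prekopa_leindler_pi {n : ℕ} {f g h : (Fin n → ℝ) → ℝ≥0∞} (hf : Measurable f)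
    (hg : Measurable g) (hh : Measurable h) {t s : ℝ} (ht : 0 < t) (hs : 0 < s) (hts : t + s = 1)
    (H : ∀ x y, f x ^ t * g y ^ s ≤ h (t • x + s • y)) :
    (∫⁻ x, f x) ^ t * (∫⁻ x, g x) ^ s ≤ ∫⁻ x, h x := by
  induction n with
  | zero =>
    have hu : ∀ u : (Fin 0 → ℝ) → ℝ≥0∞, ∫⁻ x, u x = u 0 := by
      intro u
      rw [lintegral_congr fun x => congrArg u (Subsingleton.elim x 0)]
      simp [volume_pi]
    simpa [hu] using H 0 0
  | succ n ih =>
    set e := MeasurableEquiv.piFinSuccAbove (fun _ : Fin (n + 1) => ℝ) 0 with he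
    have hsplit : ∀ {u : (Fin (n + 1) → ℝ) → ℝ≥0∞}, Measurable u →
        ∫⁻ x, u x = ∫⁻ r : ℝ, ∫⁻ y : Fin n → ℝ, u (e.symm (r, y)) := by
      intro u hu
      rw [← (volume_preserving_piFinSuccAbove (fun _ : Fin (n + 1) => ℝ) 0).symm.lintegral_comp hu,
        Measure.volume_eq_prod, lintegral_prod _ (by fun_prop)]
    have hlin : ∀ r q y z, e.symm (t * r + s * q, t • y + s • z) =
        t • e.symm (r, y) + s • e.symm (q, z) := by
      intro r q y z
      refine funext fun i => ?_
      refine Fin.cases ?_ (fun j => ?_) i <;> simp [he, MeasurableEquiv.piFinSuccAbove]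
    rw [hsplit hf, hsplit hg, hsplit hh]
    have hmeas : ∀ {u : (Fin (n + 1) → ℝ) → ℝ≥0∞}, Measurable u →
        Measurable fun r : ℝ => ∫⁻ y : Fin n → ℝ, u (e.symm (r, y)) := fun hu =>
      (hu.comp e.symm.measurable).lintegral_prod_right'
    -- The inductive hypothesis on slices is exactly the one-dimensional condition on the slice
    -- integrals.
    refine Real.prekopa_leindler (hmeas hf) (hmeas hg) (hmeas hh) ht hs hts fun r q => ?_
    refine ih (by fun_prop) (by fun_prop) (by fun_prop) fun y z => ?_
    rw [hlin]
    exact H _ _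

/-- Prékopa–Leindler inequality on Euclidean space. -/
theorem prekopa_leindler {n : ℕ} {f g h : EuclideanSpace ℝ (Fin n) → ℝ≥0∞} (hf : Measurable f)
    (hg : Measurable g) (hh : Measurable h) {t s : ℝ} (ht : 0 < t) (hs : 0 < s) (hts : t + s = 1)
    (H : ∀ x y, f x ^ t * g y ^ s ≤ h (t • x + s • y)) :
    (∫⁻ x, f x) ^ t * (∫⁻ x, g x) ^ s ≤ ∫⁻ x, h x := by
  have hp := PiLp.volume_preserving_toLp (Fin n)
  rw [← hp.lintegral_comp hf, ← hp.lintegral_comp hg, ← hp.lintegral_comp hh]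
  exact prekopa_leindler_pi (hf.comp hp.measurable) (hg.comp hp.measurable)
    (hh.comp hp.measurable) ht hs hts fun x y => H _ _

/-! ### Convexity and smoothness estimates -/

/-- A lower bound on the Hessian gives strong convexity. -/
theorem add_le_of_le_hessian {E : Type*} [NormedAddCommGroup E] [NormedSpace ℝ E] {V : E → ℝ}
    (hV : ContDiff ℝ 2 V) {c : ℝ} (hHess : ∀ x v, c * ‖v‖ ^ 2 ≤ fderiv ℝ (fderiv ℝ V) x v v)
    {t s : ℝ} (ht : 0 ≤ t) (hs : 0 ≤ s) (hts : t + s = 1) (x y : E) :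
    V (t • x + s • y) + c * t * s / 2 * ‖x - y‖ ^ 2 ≤ t * V x + s * V y := by
  set v := x - y with hv
  have hl : ∀ r : ℝ, HasDerivAt (fun r : ℝ => y + r • v) v r := fun r => by
    simpa using ((hasDerivAt_id r).smul_const v).const_add y
  have hV1 : ∀ z, HasFDerivAt V (fderiv ℝ V z) z := fun z =>
    (hV.differentiable (by norm_num) z).hasFDerivAt
  have hV2 : ∀ z, HasFDerivAt (fderiv ℝ V) (fderiv ℝ (fderiv ℝ V) z) z := fun z =>
    ((hV.fderiv_right (m := 1) (by norm_num)).differentiable (by norm_num) z).hasFDerivAt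
  have hd1 : ∀ r : ℝ, HasDerivAt (fun r : ℝ => V (y + r • v) - c / 2 * ‖v‖ ^ 2 * r ^ 2)
      (fderiv ℝ V (y + r • v) v - c * ‖v‖ ^ 2 * r) r := fun r => by
    refine (((hV1 _).comp_hasDerivAt r (hl r)).sub
      (((hasDerivAt_id r).pow 2).const_mul (c / 2 * ‖v‖ ^ 2))).congr_deriv ?_
    simp
    ring
  have hd2 : ∀ r : ℝ, HasDerivAt (fun r : ℝ => fderiv ℝ V (y + r • v) v - c * ‖v‖ ^ 2 * r)
      (fderiv ℝ (fderiv ℝ V) (y + r • v) v v - c * ‖v‖ ^ 2) r := fun r => by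
    have h1 := ((hV2 _).comp_hasDerivAt r (hl r)).clm_apply (hasDerivAt_const r v)
    refine (h1.sub ((hasDerivAt_id r).const_mul (c * ‖v‖ ^ 2))).congr_deriv ?_
    simp
  -- Removing the quadratic leaves a nonnegative second derivative along the segment. Convexity
  -- between `0` and `1` then yields the gain through `t - t² = t s`.
  have hconv : ConvexOn ℝ Set.univ fun r : ℝ => V (y + r • v) - c / 2 * ‖v‖ ^ 2 * r ^ 2 :=
    convexOn_of_hasDerivWithinAt2_nonneg convex_univ
      (fun r _ => (hd1 r).continuousAt.continuousWithinAt)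
      (fun r _ => (hd1 r).hasDerivWithinAt) (fun r _ => (hd2 r).hasDerivWithinAt)
      fun r _ => sub_nonneg.2 (hHess _ _)
  have h := hconv.2 (Set.mem_univ 1) (Set.mem_univ 0) ht hs hts
  have hz : y + t • v = t • x + s • y := by
    rw [← eq_sub_iff_add_eq'] at hts
    rw [hts, hv]
    module
  simp only [smul_eq_mul, mul_one, mul_zero, add_zero, one_smul, zero_smul, hz, one_pow] at h
  rw [show y + v = x by rw [hv]; abel] at h
  have hs' : s = 1 - t := by linarith
  subst hs'
  nlinarith [h]

/-- Mean value inequality on the ball around `z`, where the derivative varies by at most `M ‖x -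
z‖`. The sharp factor `M / 2` is not needed, as this term disappears when `s → 0`. -/
theorem LipschitzWith.sub_le_of_fderiv {E : Type*} [NormedAddCommGroup E] [NormedSpace ℝ E]
    {g : E → ℝ} (hg : Differentiable ℝ g) {M : NNReal} (hM : LipschitzWith M (fderiv ℝ g))
    (x z : E) : g x - g z ≤ ‖fderiv ℝ g z‖ * ‖x - z‖ + M * ‖x - z‖ ^ 2 := by
  have h := (convex_closedBall z ‖x - z‖).norm_image_sub_le_of_norm_fderiv_le' (𝕜 := ℝ)
    (f := g) (φ := fderiv ℝ g z) (C := M * ‖x - z‖) (x := z) (y := x) (fun y _ => hg y)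
    (fun y hy => (hM.norm_sub_le y z).trans (by
      gcongr
      simpa [dist_eq_norm] using hy)) (by simp) (by simp [dist_eq_norm])
  have h1 := (le_abs_self _).trans h
  have h2 := (le_abs_self _).trans ((fderiv ℝ g z).le_opNorm (x - z))
  linarith

theorem lintegral_gibbsMeasure_exp {n : ℕ} {V : EuclideanSpace ℝ (Fin n) → ℝ} (hV : Continuous V)
    {u : EuclideanSpace ℝ (Fin n) → ℝ} (hu : Continuous u) :
    ∫⁻ x, ENNReal.ofReal (Real.exp (u x)) ∂(gibbsMeasure V) =
      ∫⁻ x, ENNReal.ofReal (Real.exp (u x - V x)) := by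
  rw [gibbsMeasure, lintegral_withDensity_eq_lintegral_mul _ (by fun_prop) (by fun_prop)]
  refine lintegral_congr fun x => ?_
  rw [Pi.mul_apply, ← ENNReal.ofReal_mul (Real.exp_pos _).le, ← Real.exp_add]
  congr 2
  ring

/-! ### The log-Sobolev inequality for `e^g` -/

section

variable {n : ℕ} {V : EuclideanSpace ℝ (Fin n) → ℝ} {c : ℝ}

theorem integrable_of_bounded_continuous {E : Type*} [TopologicalSpace E] [MeasurableSpace E]
    [BorelSpace E] {μ : Measure E} [IsFiniteMeasure μ] {u : E → ℝ} (hu : Continuous u) {B : ℝ}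
    (hB : ∀ x, |u x| ≤ B) : Integrable u μ :=
  Integrable.of_bound hu.aestronglyMeasurable B (Eventually.of_forall hB)

/-- The Prékopa–Leindler inequality for `e^{-V} dx`, applied to `e^{g / t}` and `1`. -/
theorem rpow_integral_exp_div_le (hV : ContDiff ℝ 2 V) [IsProbabilityMeasure (gibbsMeasure V)]
    (hHess : ∀ x v, c * ‖v‖ ^ 2 ≤ fderiv ℝ (fderiv ℝ V) x v v)
    {g : EuclideanSpace ℝ (Fin n) → ℝ} (hg : ContDiff ℝ 2 g) {B L : ℝ} (hB : ∀ x, |g x| ≤ B)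
    (hL : ∀ x, ‖fderiv ℝ g x‖ ≤ L) {M : NNReal} (hM : LipschitzWith M (fderiv ℝ g))
    {t s K : ℝ} (ht : 0 < t) (hs : 0 < s) (hts : t + s = 1) (hK : 0 < K)
    (hKs : K * s = c * t - 2 * M * s) :
    (∫ x, Real.exp (g x / t) ∂(gibbsMeasure V)) ^ t ≤
      ∫ x, Real.exp (g x + ‖fderiv ℝ g x‖ ^ 2 / (2 * K)) ∂(gibbsMeasure V) := by
  have hVc := hV.continuous
  have hgc := hg.continuous
  have hdc : Continuous (fderiv ℝ g) := hM.continuous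
  have hL0 : 0 ≤ L := (norm_nonneg _).trans (hL 0)
  have hexp : ∀ {u : EuclideanSpace ℝ (Fin n) → ℝ}, Continuous u → ∀ {C : ℝ}, (∀ x, u x ≤ C) →
      Integrable (fun x => Real.exp (u x)) (gibbsMeasure V) := fun hu C hC =>
    integrable_of_bounded_continuous (by fun_prop) (B := Real.exp C) fun x => by
      rw [abs_of_pos (Real.exp_pos _)]
      exact Real.exp_le_exp.2 (hC x)
  have hi1 : Integrable (fun x => Real.exp (g x / t)) (gibbsMeasure V) :=
    hexp (by fun_prop) (C := B / t) fun x => by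
      gcongr
      exact (le_abs_self _).trans (hB x)
  have hi2 : Integrable (fun x => Real.exp (g x + ‖fderiv ℝ g x‖ ^ 2 / (2 * K)))
      (gibbsMeasure V) :=
    hexp (by fun_prop) (C := B + L ^ 2 / (2 * K)) fun x => by
      gcongr
      · exact (le_abs_self _).trans (hB x)
      · exact hL x
  have hPL := prekopa_leindler (f := fun x => ENNReal.ofReal (Real.exp (g x / t - V x)))
    (g := fun x => ENNReal.ofReal (Real.exp (0 - V x)))
    (h := fun x => ENNReal.ofReal (Real.exp (g x + ‖fderiv ℝ g x‖ ^ 2 / (2 * K) - V x)))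
    (by fun_prop) (by fun_prop) (by fun_prop) ht hs hts (by
      intro x y
      set z := t • x + s • y with hz
      rw [ENNReal.ofReal_rpow_of_pos (Real.exp_pos _), ENNReal.ofReal_rpow_of_pos (Real.exp_pos _),
        ← Real.exp_mul, ← Real.exp_mul, ← ENNReal.ofReal_mul (Real.exp_pos _).le, ← Real.exp_add]
      refine ENNReal.ofReal_le_ofReal (Real.exp_le_exp.2 ?_)
      have h1 := add_le_of_le_hessian hV hHess ht.le hs.le hts x y
      have h2 := hM.sub_le_of_fderiv (hg.differentiable (by norm_num)) x z
      have h3 : ‖x - z‖ = s * ‖x - y‖ := by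
        rw [show x - z = s • (x - y) by
          rw [hz, ← eq_sub_iff_add_eq.2 hts |>.symm]
          module, norm_smul, Real.norm_of_nonneg hs.le]
      rw [h3] at h2
      set D := ‖fderiv ℝ g z‖
      set r := ‖x - y‖
      -- Young's inequality with weight `K`. By `hKs`, its quadratic term together with the Taylor
      -- error `M s² r²` equals the convexity gain `c t s r² / 2`.
      have h4 : D * (s * r) ≤ D ^ 2 / (2 * K) + K * s * s * r ^ 2 / 2 := by
        have h5 : D ^ 2 / (2 * K) + K * s * s * r ^ 2 / 2 - D * (s * r) =
            (D - K * s * r) ^ 2 / (2 * K) := by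
          field_simp
          ring
        have h6 : 0 ≤ (D - K * s * r) ^ 2 / (2 * K) := by positivity
        linarith
      rw [hKs] at h4
      have h7 : (g x / t - V x) * t = g x - t * V x := by field_simp
      rw [h7]
      nlinarith [h1, h2, h4])
  rw [← lintegral_gibbsMeasure_exp hVc (by fun_prop), ← lintegral_gibbsMeasure_exp hVc (by fun_prop),
    ← lintegral_gibbsMeasure_exp hVc (by fun_prop),
    ← ofReal_integral_eq_lintegral_ofReal hi1 (Eventually.of_forall fun _ => (Real.exp_pos _).le),
    ← ofReal_integral_eq_lintegral_ofReal hi2 (Eventually.of_forall fun _ => (Real.exp_pos _).le),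
    ENNReal.ofReal_rpow_of_nonneg (integral_nonneg fun _ => (Real.exp_pos _).le) ht.le] at hPL
  simp only [Real.exp_zero, ENNReal.ofReal_one, lintegral_one, measure_univ, ENNReal.one_rpow,
    mul_one] at hPL
  exact (ENNReal.ofReal_le_ofReal_iff (integral_nonneg fun _ => (Real.exp_pos _).le)).1 hPL

/-- The logarithmic Sobolev inequality for `e^g` up to an error that vanishes as `s → 0`. -/
theorem integral_exp_entropy_le_of_pos (hV : ContDiff ℝ 2 V)
    [IsProbabilityMeasure (gibbsMeasure V)]
    (hHess : ∀ x v, c * ‖v‖ ^ 2 ≤ fderiv ℝ (fderiv ℝ V) x v v)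
    {g : EuclideanSpace ℝ (Fin n) → ℝ} (hg : ContDiff ℝ 2 g) {B L : ℝ} (hB : ∀ x, |g x| ≤ B)
    (hL : ∀ x, ‖fderiv ℝ g x‖ ≤ L) {M : NNReal} (hM : LipschitzWith M (fderiv ℝ g))
    {s : ℝ} (hs : 0 < s) (hs1 : s < 1) (hsM : 0 < c * (1 - s) - 2 * M * s) :
    (∫ x, g x * Real.exp (g x) ∂(gibbsMeasure V)) -
        (∫ x, Real.exp (g x) ∂(gibbsMeasure V)) *
          Real.log (∫ x, Real.exp (g x) ∂(gibbsMeasure V)) ≤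
      Real.exp (L ^ 2 * s / (2 * (c * (1 - s) - 2 * M * s))) /
        (2 * (c * (1 - s) - 2 * M * s)) *
          ∫ x, ‖fderiv ℝ g x‖ ^ 2 * Real.exp (g x) ∂(gibbsMeasure V) := by
  set μ := gibbsMeasure V with hμ
  set q := c * (1 - s) - 2 * M * s with hq
  have hgc := hg.continuous
  have hdc : Continuous (fderiv ℝ g) := hM.continuous
  have hL0 : 0 ≤ L := (norm_nonneg _).trans (hL 0)
  have ht : 0 < 1 - s := by linarith
  have hg1 : ∀ x, g x ≤ B := fun x => (le_abs_self _).trans (hB x)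
  have hE : ∀ x, |Real.exp (g x)| ≤ Real.exp B := fun x => by
    rw [abs_of_pos (Real.exp_pos _)]
    exact Real.exp_le_exp.2 (hg1 x)
  have hiE : Integrable (fun x => Real.exp (g x)) μ :=
    integrable_of_bounded_continuous (by fun_prop) hE
  have higE : Integrable (fun x => g x * Real.exp (g x)) μ :=
    integrable_of_bounded_continuous (by fun_prop) (B := B * Real.exp B) fun x => by
      rw [abs_mul]
      exact mul_le_mul (hB x) (hE x) (abs_nonneg _) ((abs_nonneg _).trans (hB x))
  have hidE : Integrable (fun x => ‖fderiv ℝ g x‖ ^ 2 * Real.exp (g x)) μ :=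
    integrable_of_bounded_continuous (by fun_prop) (B := L ^ 2 * Real.exp B) fun x => by
      rw [abs_mul, abs_of_nonneg (sq_nonneg _)]
      exact mul_le_mul (by gcongr; exact hL x) (hE x) (abs_nonneg _) (sq_nonneg _)
  have hiT : Integrable (fun x => Real.exp (g x / (1 - s))) μ :=
    integrable_of_bounded_continuous (by fun_prop) (B := Real.exp (B / (1 - s))) fun x => by
      rw [abs_of_pos (Real.exp_pos _)]
      refine Real.exp_le_exp.2 ?_
      gcongr
      exact hg1 x
  set Z := ∫ x, Real.exp (g x) ∂μ with hZ
  set J := ∫ x, g x * Real.exp (g x) ∂μ with hJ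
  set I := ∫ x, ‖fderiv ℝ g x‖ ^ 2 * Real.exp (g x) ∂μ with hI
  have hZ0 : 0 < Z := integral_exp_pos hiE
  have hPL := rpow_integral_exp_div_le hV hHess hg hB hL hM ht hs (by ring) (K := q / s)
    (by positivity) (by rw [div_mul_cancel₀ _ hs.ne'])
  -- The mean of `g` under the probability measure `e^g μ / Z`.
  set m := J / Z with hm
  -- Jensen's inequality under that measure, proved by integrating the tangent line of the
  -- exponential at the mean.
  have hlow : Real.exp (s / (1 - s) * m) * Z ≤ ∫ x, Real.exp (g x / (1 - s)) ∂μ := by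
    have h1 : ∫ x, (Real.exp (s / (1 - s) * m) * (1 - s / (1 - s) * m) * Real.exp (g x) +
        Real.exp (s / (1 - s) * m) * (s / (1 - s)) * (g x * Real.exp (g x))) ∂μ =
        Real.exp (s / (1 - s) * m) * Z := by
      rw [integral_add (hiE.const_mul _) (higE.const_mul _), integral_const_mul,
        integral_const_mul, ← hZ, ← hJ, show J = m * Z by rw [hm]; field_simp]
      ring
    rw [← h1]
    refine integral_mono ((hiE.const_mul _).add (higE.const_mul _)) hiT fun x => ?_
    have h2 := Real.add_one_le_exp (s / (1 - s) * g x - s / (1 - s) * m)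
    have h3 : Real.exp (g x / (1 - s)) = Real.exp (s / (1 - s) * m) *
        Real.exp (s / (1 - s) * g x - s / (1 - s) * m) * Real.exp (g x) := by
      rw [← Real.exp_add, ← Real.exp_add]
      congr 1
      field_simp
      ring
    rw [h3]
    have h4 := mul_le_mul_of_nonneg_left h2
      (mul_pos (Real.exp_pos (s / (1 - s) * m)) (Real.exp_pos (g x))).le
    calc _ = Real.exp (s / (1 - s) * m) * Real.exp (g x) *
          (s / (1 - s) * g x - s / (1 - s) * m + 1) := by ring
      _ ≤ _ := h4
      _ = _ := by ring
  have hup : ∫ x, Real.exp (g x + ‖fderiv ℝ g x‖ ^ 2 / (2 * (q / s))) ∂μ ≤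
      Z + Real.exp (L ^ 2 * s / (2 * q)) * s / (2 * q) * I := by
    rw [hZ, hI, ← integral_const_mul, ← integral_add hiE (hidE.const_mul _)]
    refine integral_mono_of_nonneg (Eventually.of_forall fun _ => (Real.exp_pos _).le)
      (hiE.add (hidE.const_mul _)) (Eventually.of_forall fun x => ?_)
    set A := ‖fderiv ℝ g x‖ ^ 2 / (2 * (q / s)) with hA
    have hA0 : 0 ≤ A := by positivity
    have hA1 : A ≤ L ^ 2 * s / (2 * q) := by
      rw [show L ^ 2 * s / (2 * q) = L ^ 2 / (2 * (q / s)) by field_simp, hA]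
      gcongr
      exact hL x
    -- This is `1 - A ≤ e^{-A}` multiplied by `e^A`. It keeps the factor `A`, hence `s`, explicit.
    have h1 : Real.exp A ≤ 1 + A * Real.exp A := by
      have h2 := Real.add_one_le_exp (-A)
      have h3 := mul_le_mul_of_nonneg_right h2 (Real.exp_pos A).le
      rw [← Real.exp_add, neg_add_cancel, Real.exp_zero] at h3
      linarith
    have h2 : A * Real.exp A ≤ A * Real.exp (L ^ 2 * s / (2 * q)) := by gcongr
    have h3 : Real.exp (L ^ 2 * s / (2 * q)) * s / (2 * q) *
        (‖fderiv ℝ g x‖ ^ 2 * Real.exp (g x)) =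
        A * Real.exp (L ^ 2 * s / (2 * q)) * Real.exp (g x) := by
      rw [hA]
      field_simp
    have h4 := mul_le_mul_of_nonneg_right (h1.trans (add_le_add_right h2 1)) (Real.exp_pos (g x)).le
    simp only [h3]
    rw [Real.exp_add]
    linarith
  have hlow2 : Z * Real.exp (s * (m - Real.log Z)) ≤
      (∫ x, Real.exp (g x / (1 - s)) ∂μ) ^ (1 - s) := by
    refine le_trans (le_of_eq ?_) (Real.rpow_le_rpow (by positivity) hlow ht.le)
    rw [Real.mul_rpow (Real.exp_pos _).le hZ0.le, ← Real.exp_mul, Real.rpow_def_of_pos hZ0,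
      ← Real.exp_add]
    nth_rewrite 1 [← Real.exp_log hZ0]
    rw [← Real.exp_add]
    congr 1
    field_simp
    ring
  have h1 := hlow2.trans (hPL.trans hup)
  -- Linearising the left side makes the zeroth-order terms `Z` cancel, and a factor `s` can be
  -- divided out.
  have h2 := mul_le_mul_of_nonneg_left (Real.add_one_le_exp (s * (m - Real.log Z))) hZ0.le
  have h3 : Z * (s * (m - Real.log Z) + 1) = s * (J - Z * Real.log Z) + Z := by
    rw [hm]
    field_simp
  have h4 : s * (J - Z * Real.log Z) ≤ s * (Real.exp (L ^ 2 * s / (2 * q)) / (2 * q) * I) := by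
    have h5 : Real.exp (L ^ 2 * s / (2 * q)) * s / (2 * q) * I =
        s * (Real.exp (L ^ 2 * s / (2 * q)) / (2 * q) * I) := by ring
    linarith
  exact le_of_mul_le_mul_left h4 hs

/-- The logarithmic Sobolev inequality for `e^g` with `g` bounded, with bounded and Lipschitz
derivative. -/
theorem integral_exp_entropy_le (hV : ContDiff ℝ 2 V)
    [IsProbabilityMeasure (gibbsMeasure V)] (hc : 0 < c)
    (hHess : ∀ x v, c * ‖v‖ ^ 2 ≤ fderiv ℝ (fderiv ℝ V) x v v)
    {g : EuclideanSpace ℝ (Fin n) → ℝ} (hg : ContDiff ℝ 2 g) {B L : ℝ} (hB : ∀ x, |g x| ≤ B)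
    (hL : ∀ x, ‖fderiv ℝ g x‖ ≤ L) {M : NNReal} (hM : LipschitzWith M (fderiv ℝ g)) :
    (∫ x, g x * Real.exp (g x) ∂(gibbsMeasure V)) -
        (∫ x, Real.exp (g x) ∂(gibbsMeasure V)) *
          Real.log (∫ x, Real.exp (g x) ∂(gibbsMeasure V)) ≤
      1 / (2 * c) * ∫ x, ‖fderiv ℝ g x‖ ^ 2 * Real.exp (g x) ∂(gibbsMeasure V) := by
  have hlim : Tendsto (fun s : ℝ => Real.exp (L ^ 2 * s / (2 * (c * (1 - s) - 2 * M * s))) /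
      (2 * (c * (1 - s) - 2 * M * s)) *
        ∫ x, ‖fderiv ℝ g x‖ ^ 2 * Real.exp (g x) ∂(gibbsMeasure V)) (𝓝[>] 0)
      (𝓝 (1 / (2 * c) * ∫ x, ‖fderiv ℝ g x‖ ^ 2 * Real.exp (g x) ∂(gibbsMeasure V))) := by
    have hca : ContinuousAt (fun s : ℝ => Real.exp (L ^ 2 * s / (2 * (c * (1 - s) - 2 * M * s))) /
        (2 * (c * (1 - s) - 2 * M * s)) *
          ∫ x, ‖fderiv ℝ g x‖ ^ 2 * Real.exp (g x) ∂(gibbsMeasure V)) 0 := by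
      have h0 : 2 * (c * (1 - (0 : ℝ)) - 2 * M * 0) ≠ 0 := by simp [hc.ne']
      fun_prop (disch := exact h0)
    have := hca.tendsto.mono_left (nhdsWithin_le_nhds (s := Set.Ioi 0))
    simpa using this
  have hq : ∀ᶠ s : ℝ in 𝓝[>] 0, 0 < c * (1 - s) - 2 * M * s := by
    have hca : ContinuousAt (fun s : ℝ => c * (1 - s) - 2 * M * s) 0 := by fun_prop
    exact (hca.eventually (lt_mem_nhds (by simpa using hc))).filter_mono nhdsWithin_le_nhds
  refine ge_of_tendsto hlim ?_
  filter_upwards [hq, self_mem_nhdsWithin, nhdsWithin_le_nhds (gt_mem_nhds one_pos)] with s h1 h2 h3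
  exact integral_exp_entropy_le_of_pos hV hHess hg hB hL hM h2 h3 h1

end

/-! ### Squares of compactly supported functions -/

/-- A crude form of the minimum `-1/e`, from `1 - 1/y ≤ log y`. It makes `y log y + 1` nonnegative,
as Fatou's lemma requires. -/
theorem Real.neg_one_le_mul_log {y : ℝ} (hy : 0 ≤ y) : -1 ≤ y * Real.log y := by
  rcases hy.eq_or_lt with rfl | hy0
  · simp
  · have h := mul_le_mul_of_nonneg_left (Real.one_sub_inv_le_log_of_pos hy0) hy
    rw [mul_sub, mul_inv_cancel₀ hy0.ne'] at h
    linarith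

theorem norm_gradient_eq_norm_fderiv {E : Type*} [NormedAddCommGroup E] [InnerProductSpace ℝ E]
    [CompleteSpace E] (u : E → ℝ) (x : E) : ‖gradient u x‖ = ‖fderiv ℝ u x‖ :=
  LinearIsometryEquiv.norm_map _ _

/-- The logarithmic Sobolev inequality for `√(φ² + ε)` with `φ` smooth and compactly supported. -/
theorem entropy_sq_add_le {n : ℕ} {V : EuclideanSpace ℝ (Fin n) → ℝ} {c : ℝ}
    (hV : ContDiff ℝ 2 V) [IsProbabilityMeasure (gibbsMeasure V)] (hc : 0 < c)
    (hHess : ∀ x v, c * ‖v‖ ^ 2 ≤ fderiv ℝ (fderiv ℝ V) x v v)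
    {φ : EuclideanSpace ℝ (Fin n) → ℝ} (hφ : ContDiff ℝ 2 φ) (hφc : HasCompactSupport φ)
    {ε : ℝ} (hε : 0 < ε) :
    entropy (gibbsMeasure V) (fun x => φ x ^ 2 + ε) ≤
      2 / c * ∫ x, ‖gradient φ x‖ ^ 2 ∂(gibbsMeasure V) := by
  have hpos : ∀ x, 0 < φ x ^ 2 + ε := fun x => by positivity
  set g : EuclideanSpace ℝ (Fin n) → ℝ := fun x => Real.log (φ x ^ 2 + ε) with hgdef
  have hg : ContDiff ℝ 2 g := ((hφ.pow 2).add contDiff_const).log fun x => (hpos x).ne'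
  have hdg : ∀ x, fderiv ℝ g x = (φ x ^ 2 + ε)⁻¹ • ((2 * φ x) • fderiv ℝ φ x) := by
    intro x
    have h1 := (hφ.differentiable (by norm_num) x).hasFDerivAt
    have h2 : HasFDerivAt g _ x := ((h1.pow 2).add_const ε).log (hpos x).ne'
    rw [h2.fderiv]
    simp
  -- Off the support of `φ`, `g` is the constant `log ε`. This gives the bounds on `g` and its
  -- derivative, and the Lipschitz constant of the latter.
  have hgc : HasCompactSupport fun x => g x - Real.log ε :=
    hφc.comp_left (g := fun y => Real.log (y ^ 2 + ε) - Real.log ε) (by simp)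
  have hdgc : HasCompactSupport (fderiv ℝ g) := by
    have h1 := hgc.fderiv ℝ
    have h2 : fderiv ℝ (fun x => g x - Real.log ε) = fderiv ℝ g := funext fun x =>
      fderiv_sub_const _
    rwa [h2] at h1
  have hdg1 : ContDiff ℝ 1 (fderiv ℝ g) := hg.fderiv_right (by norm_num)
  obtain ⟨B, hB⟩ := hgc.exists_bound_of_continuous (hg.continuous.sub continuous_const)
  obtain ⟨L, hL⟩ := hdgc.exists_bound_of_continuous hdg1.continuous
  obtain ⟨M, hM⟩ := ContDiff.lipschitzWith_of_hasCompactSupport hdgc hdg1 one_ne_zero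
  have key := integral_exp_entropy_le hV hc hHess hg (B := B + |Real.log ε|) (fun x => by
    have h1 := abs_add_le (g x - Real.log ε) (Real.log ε)
    rw [sub_add_cancel] at h1
    exact h1.trans (add_le_add_left (hB x) _)) hL hM
  have hexp : ∀ x, Real.exp (g x) = φ x ^ 2 + ε := fun x => Real.exp_log (hpos x)
  simp only [hexp] at key
  have hent : entropy (gibbsMeasure V) (fun x => φ x ^ 2 + ε) =
      (∫ x, g x * (φ x ^ 2 + ε) ∂(gibbsMeasure V)) - (∫ x, (φ x ^ 2 + ε) ∂(gibbsMeasure V)) *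
        Real.log (∫ x, (φ x ^ 2 + ε) ∂(gibbsMeasure V)) := by
    simp only [entropy, hgdef, mul_comm (Real.log _)]
  rw [hent]
  refine key.trans ?_
  have hle : ∫ x, ‖fderiv ℝ g x‖ ^ 2 * (φ x ^ 2 + ε) ∂(gibbsMeasure V) ≤
      ∫ x, 4 * ‖gradient φ x‖ ^ 2 ∂(gibbsMeasure V) := by
    have hdφ : Continuous (fderiv ℝ φ) := hφ.continuous_fderiv (by norm_num)
    obtain ⟨L', hL'⟩ := (hφc.fderiv ℝ).exists_bound_of_continuous hdφ
    simp only [norm_gradient_eq_norm_fderiv]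
    refine integral_mono_of_nonneg (Eventually.of_forall fun x => by have := hpos x; positivity)
      ((integrable_of_bounded_continuous (by fun_prop) (B := L' ^ 2) fun x => ?_).const_mul 4)
      (Eventually.of_forall fun x => ?_)
    · rw [abs_of_nonneg (sq_nonneg _)]
      gcongr
      exact hL' x
    · have h0 := hpos x
      simp only [hdg, norm_smul, norm_inv, Real.norm_of_nonneg h0.le]
      have h1 : ((φ x ^ 2 + ε)⁻¹ * (‖2 * φ x‖ * ‖fderiv ℝ φ x‖)) ^ 2 * (φ x ^ 2 + ε) =
          φ x ^ 2 / (φ x ^ 2 + ε) * (4 * ‖fderiv ℝ φ x‖ ^ 2) := by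
        rw [Real.norm_eq_abs, mul_pow, mul_pow, sq_abs]
        field_simp
        ring
      rw [h1]
      refine mul_le_of_le_one_left (by positivity) ((div_le_one h0).2 (by linarith))
  rw [integral_const_mul] at hle
  calc _ ≤ 1 / (2 * c) * (4 * ∫ x, ‖gradient φ x‖ ^ 2 ∂(gibbsMeasure V)) := by gcongr
    _ = _ := by field_simp; ring

/-- The logarithmic Sobolev inequality for smooth compactly supported functions. -/
theorem entropy_sq_le_of_hasCompactSupport {n : ℕ} {V : EuclideanSpace ℝ (Fin n) → ℝ} {c : ℝ}
    (hV : ContDiff ℝ 2 V) [IsProbabilityMeasure (gibbsMeasure V)] (hc : 0 < c)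
    (hHess : ∀ x v, c * ‖v‖ ^ 2 ≤ fderiv ℝ (fderiv ℝ V) x v v)
    {φ : EuclideanSpace ℝ (Fin n) → ℝ} (hφ : ContDiff ℝ 2 φ) (hφc : HasCompactSupport φ) :
    entropy (gibbsMeasure V) (fun x => φ x ^ 2) ≤
      2 / c * ∫ x, ‖gradient φ x‖ ^ 2 ∂(gibbsMeasure V) := by
  have hcont := hφ.continuous
  obtain ⟨B, hB⟩ := hφc.exists_bound_of_continuous hcont
  have hε : Tendsto (fun k : ℕ => 1 / ((k : ℝ) + 1)) atTop (𝓝 0) :=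
    tendsto_one_div_add_atTop_nhds_zero_nat
  have hε0 : ∀ k : ℕ, 0 < 1 / ((k : ℝ) + 1) := fun k => by positivity
  have hε1 : ∀ k : ℕ, 1 / ((k : ℝ) + 1) ≤ 1 := fun k => by
    rw [div_le_one (by positivity)]
    linarith [k.cast_nonneg (α := ℝ)]
  -- All arguments of `ψ` stay in the compact interval `[0, B² + 1]`, so a constant dominates. The
  -- two uses are `y log y` and the identity.
  have hlim : ∀ {ψ : ℝ → ℝ}, Continuous ψ →
      Tendsto (fun k : ℕ => ∫ x, ψ (φ x ^ 2 + 1 / ((k : ℝ) + 1)) ∂(gibbsMeasure V)) atTop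
        (𝓝 (∫ x, ψ (φ x ^ 2) ∂(gibbsMeasure V))) := by
    intro ψ hψ
    obtain ⟨C, hC⟩ := (isCompact_Icc (a := (0 : ℝ)) (b := B ^ 2 + 1)).exists_bound_of_continuousOn
      hψ.continuousOn
    refine tendsto_integral_of_dominated_convergence (fun _ => C)
      (fun k => (by fun_prop : Continuous _).aestronglyMeasurable) (integrable_const C)
      (fun k => Eventually.of_forall fun x => hC _ ⟨?_, ?_⟩) (Eventually.of_forall fun x => ?_)
    · have := hε0 k
      positivity
    · have h1 : φ x ^ 2 ≤ B ^ 2 := by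
        rw [← sq_abs]
        gcongr
        exact hB x
      linarith [hε1 k]
    · have h1 : Tendsto (fun k : ℕ => φ x ^ 2 + 1 / ((k : ℝ) + 1)) atTop (𝓝 (φ x ^ 2)) := by
        simpa using hε.const_add (φ x ^ 2)
      exact (hψ.tendsto _).comp h1
  have h1 := hlim Real.continuous_mul_log
  have h2 := (Real.continuous_mul_log.tendsto _).comp (hlim continuous_id)
  refine le_of_tendsto' (h1.sub h2) fun k => ?_
  exact entropy_sq_add_le hV hc hHess hφ hφc (hε0 k)

/-! ### Passage to the Dirichlet domain -/

/-- Convergence in `L²` implies convergence of the integrals of the squared norms. -/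
theorem tendsto_integral_norm_sq_of_eLpNorm {α F : Type*} [MeasurableSpace α]
    [NormedAddCommGroup F] {μ : Measure α} {u : ℕ → α → F} {w : α → F}
    (hu : ∀ k, MemLp (u k) 2 μ) (hw : MemLp w 2 μ)
    (h : Tendsto (fun k => eLpNorm (fun x => u k x - w x) 2 μ) atTop (𝓝 0)) :
    Tendsto (fun k => ∫ x, ‖u k x‖ ^ 2 ∂μ) atTop (𝓝 (∫ x, ‖w x‖ ^ 2 ∂μ)) := by
  have hsq : ∀ {v : α → F} (hv : MemLp v 2 μ), ‖hv.toLp‖ ^ 2 = ∫ x, ‖v x‖ ^ 2 ∂μ := by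
    intro v hv
    have hi : 0 ≤ ∫ x, ‖v x‖ ^ 2 ∂μ := integral_nonneg fun x => sq_nonneg _
    rw [Lp.norm_toLp, hv.eLpNorm_eq_integral_rpow_norm two_ne_zero ENNReal.ofNat_ne_top,
      ENNReal.toReal_ofReal (by positivity)]
    simp only [ENNReal.toReal_ofNat, Real.rpow_ofNat]
    rw [← Real.rpow_natCast, ← Real.rpow_mul hi]
    simp
  have h1 := (Lp.tendsto_Lp_iff_tendsto_eLpNorm'' u hu w hw).2 h
  have h2 := (h1.norm).pow 2
  simpa only [hsq] using h2

/-- Lower semicontinuity of the entropy under `L²` convergence. -/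
theorem integrable_and_entropy_sq_le_of_tendsto {n : ℕ}
    {μ : Measure (EuclideanSpace ℝ (Fin n))} [IsProbabilityMeasure μ]
    {φ : ℕ → EuclideanSpace ℝ (Fin n) → ℝ} {f : EuclideanSpace ℝ (Fin n) → ℝ}
    (hφ : ∀ k, MemLp (φ k) 2 μ)
    (hφl : ∀ k, Integrable (fun x => φ k x ^ 2 * Real.log (φ k x ^ 2)) μ) (hf : MemLp f 2 μ)
    (h : Tendsto (fun k => eLpNorm (fun x => φ k x - f x) 2 μ) atTop (𝓝 0))
    {b : ℕ → ℝ} {b₀ : ℝ} (hb : Tendsto b atTop (𝓝 b₀))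
    (hle : ∀ k, entropy μ (fun x => φ k x ^ 2) ≤ b k) :
    Integrable (fun x => f x ^ 2 * Real.log (f x ^ 2)) μ ∧ entropy μ (fun x => f x ^ 2) ≤ b₀ := by
  obtain ⟨ns, hns, hae⟩ := (tendstoInMeasure_of_tendsto_eLpNorm two_ne_zero
    (fun k => (hφ k).1) hf.1 h).exists_seq_tendsto_ae
  have hsq := tendsto_integral_norm_sq_of_eLpNorm hφ hf h
  simp only [Real.norm_eq_abs, sq_abs] at hsq
  set S := ∫ x, f x ^ 2 ∂μ with hS
  have hbound : Tendsto (fun k => b k + (∫ x, φ k x ^ 2 ∂μ) * Real.log (∫ x, φ k x ^ 2 ∂μ) + 1)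
      atTop (𝓝 (b₀ + S * Real.log S + 1)) :=
    (hb.add ((Real.continuous_mul_log.tendsto _).comp hsq)).add_const 1
  have hnn : ∀ y : ℝ, 0 ≤ y ^ 2 * Real.log (y ^ 2) + 1 := fun y => by
    linarith [Real.neg_one_le_mul_log (sq_nonneg y)]
  have hψ : Continuous fun y : ℝ => y ^ 2 * Real.log (y ^ 2) :=
    Real.continuous_mul_log.comp (continuous_pow 2)
  have hint : ∀ k, ∫⁻ x, ENNReal.ofReal (φ k x ^ 2 * Real.log (φ k x ^ 2) + 1) ∂μ ≤
      ENNReal.ofReal (b k + (∫ x, φ k x ^ 2 ∂μ) * Real.log (∫ x, φ k x ^ 2 ∂μ) + 1) := by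
    intro k
    have hi : Integrable (fun x => φ k x ^ 2 * Real.log (φ k x ^ 2) + 1) μ :=
      (hφl k).add (integrable_const 1)
    rw [← ofReal_integral_eq_lintegral_ofReal hi
      (Eventually.of_forall fun x => hnn _), integral_add (hφl k) (integrable_const 1)]
    refine ENNReal.ofReal_le_ofReal ?_
    have := hle k
    simp only [entropy] at this
    simp only [integral_const, probReal_univ, smul_eq_mul, mul_one]
    linarith
  have hmeas : ∀ {u : EuclideanSpace ℝ (Fin n) → ℝ}, MemLp u 2 μ →
      AEStronglyMeasurable (fun x => u x ^ 2 * Real.log (u x ^ 2)) μ := fun hu =>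
    hψ.comp_aestronglyMeasurable hu.1
  -- Fatou's lemma along an a.e. convergent subsequence; the shift by `1` makes the integrands
  -- nonnegative.
  have hfatou : ∫⁻ x, ENNReal.ofReal (f x ^ 2 * Real.log (f x ^ 2) + 1) ∂μ ≤
      ENNReal.ofReal (b₀ + S * Real.log S + 1) := by
    have h1 : ∫⁻ x, ENNReal.ofReal (f x ^ 2 * Real.log (f x ^ 2) + 1) ∂μ =
        ∫⁻ x, liminf (fun k => ENNReal.ofReal
          (φ (ns k) x ^ 2 * Real.log (φ (ns k) x ^ 2) + 1)) atTop ∂μ := by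
      refine lintegral_congr_ae ?_
      filter_upwards [hae] with x hx
      refine (Tendsto.liminf_eq ?_).symm
      exact ENNReal.tendsto_ofReal (((hψ.tendsto _).comp hx).add_const 1)
    rw [h1]
    refine (lintegral_liminf_le' fun k =>
      ((hmeas (hφ (ns k))).aemeasurable.add_const 1).ennreal_ofReal).trans ?_
    have h2 := (ENNReal.tendsto_ofReal hbound).comp hns.tendsto_atTop
    rw [← h2.liminf_eq]
    exact liminf_le_liminf (Eventually.of_forall fun k => hint (ns k))
  have hi1 : Integrable (fun x => f x ^ 2 * Real.log (f x ^ 2) + 1) μ := by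
    refine ⟨(hmeas hf).add aestronglyMeasurable_const, ?_⟩
    rw [hasFiniteIntegral_iff_ofReal (Eventually.of_forall fun x => hnn _)]
    exact hfatou.trans_lt ENNReal.ofReal_lt_top
  have hi : Integrable (fun x => f x ^ 2 * Real.log (f x ^ 2)) μ := by
    refine (hi1.sub (integrable_const (1 : ℝ))).congr (Eventually.of_forall fun x => ?_)
    exact add_sub_cancel_right _ _
  refine ⟨hi, ?_⟩
  rw [← ofReal_integral_eq_lintegral_ofReal hi1 (Eventually.of_forall fun x => hnn _)] at hfatou
  -- `ENNReal.ofReal` sends negative numbers to `0`, so the bound must be known nonnegative before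
  -- returning to real numbers.
  have h0 : 0 ≤ b₀ + S * Real.log S + 1 := by
    refine ge_of_tendsto' hbound fun k => ?_
    have h1 := hle k
    simp only [entropy] at h1
    have h2 : -1 ≤ ∫ x, φ k x ^ 2 * Real.log (φ k x ^ 2) ∂μ := by
      have h3 := integral_mono (μ := μ) (integrable_const (-1)) (hφl k)
        fun x => Real.neg_one_le_mul_log (sq_nonneg (φ k x))
      simpa using h3
    linarith
  have h1 := (ENNReal.ofReal_le_ofReal_iff h0).1 hfatou
  rw [integral_add hi (integrable_const 1)] at h1
  simp only [integral_const, probReal_univ, smul_eq_mul, mul_one] at h1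
  simp only [entropy, ← hS]
  linarith

theorem proposition1p1 {n : ℕ} (V : EuclideanSpace ℝ (Fin n) → ℝ) (hV : ContDiff ℝ 2 V)
    (hμ : IsProbabilityMeasure (gibbsMeasure V)) (c : ℝ) (hc : 0 < c)
    (hHess : ∀ x v : EuclideanSpace ℝ (Fin n),
      c * ‖v‖ ^ 2 ≤ fderiv ℝ (fderiv ℝ V) x v v) :
    LogSobolev (gibbsMeasure V) (2 / c) := by
  intro f hf
  -- The chosen gradient comes with its own approximating sequence, along which the inequality is
  -- passed to the limit.
  have hgrad : IsDirichletGradient (gibbsMeasure V) f (dirichletGradient (gibbsMeasure V) f) := by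
    have hf' : ∃ G, IsDirichletGradient (gibbsMeasure V) f G := hf
    rw [dirichletGradient, dif_pos hf']
    exact hf'.choose_spec
  obtain ⟨hf2, hG, φ, hφ, hφc, hφf, hφG⟩ := hgrad
  have hφ2 : ∀ k, ContDiff ℝ 2 (φ k) := fun k => (hφ k).of_le (by norm_cast)
  have hφm : ∀ k, MemLp (φ k) 2 (gibbsMeasure V) := fun k =>
    (hφ k).continuous.memLp_of_hasCompactSupport (hφc k)
  have hdφm : ∀ k, MemLp (gradient (φ k)) 2 (gibbsMeasure V) := fun k =>
    ((LinearIsometryEquiv.continuous _).comp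
      ((hφ k).continuous_fderiv (by simp))).memLp_of_hasCompactSupport
      (((hφc k).fderiv ℝ).comp_left
        (g := (InnerProductSpace.toDual ℝ (EuclideanSpace ℝ (Fin n))).symm) (by simp))
  have hφl : ∀ k, Integrable (fun x => φ k x ^ 2 * Real.log (φ k x ^ 2)) (gibbsMeasure V) :=
    fun k => ((Real.continuous_mul_log.comp (continuous_pow 2)).comp
      (hφ k).continuous).integrable_of_hasCompactSupport
        ((hφc k).comp_left (g := fun y => y ^ 2 * Real.log (y ^ 2)) (by simp))
  have h := integrable_and_entropy_sq_le_of_tendsto hφm hφl hf2 hφf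
    ((tendsto_integral_norm_sq_of_eLpNorm hdφm hG hφG).const_mul (2 / c))
    fun k => entropy_sq_le_of_hasCompactSupport hV hc hHess (hφ2 k) (hφc k)
  refine ⟨h.1, h.2.trans_eq ?_⟩
  simp only [dirichletForm, real_inner_self_eq_norm_sq]
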